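/- **Proposition 3.13.** Let $\mathbb{C}\langle\mathbf{X}\rangle$ be the algebra of noncommutative polynomials over $\mathbb{C}$ in the variables $\mathbf{X}_1,\mathbf{X}_2,\dots$, with the (conjugate-linear, order-reversing) involution for which every $\mathbf{X}_\ell$ is self-adjoint. For $n\ge 1$ let $\mathrm{Mat}_n(\mathbb{C}\langle\mathbf{X}\rangle)$ carry the involution $A^*(i,j)=A(j,i)^*$. Let $\mathcal{H}$ be the Hilbert space with orthonormal basis $\{v(i_1\cdots i_k)\}$ indexed by all finite sequences of positive integers, including the empty one; put $1_{\mathcal H}=v(\emptyset)$ and $\phi(A)=(1_{\mathcal H},A1_{\mathcal H})$ for $A\in B(\mathcal{H})$. Let $\Sigma_\ell\in B(\mathcal H)$ be the isometry $\Sigma_\ell v(i_1\cdots i_k)=v(\ell\, i_1\cdots i_k)$, and put $$\Xi_\ell=\mathrm{i}^{\ell}\,\Sigma_\ell+\mathrm{i}^{-\ell}\,\Sigma_\ell^*\qquad(\ell=1,2,\dots),\qquad \Xi=\{\Xi_\ell\}_{\ell=1}^\infty .$$ For $f\in\mathrm{Mat}_n(\mathbb{C}\langle\mathbf{X}\rangle)$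 let $f(\Xi)\in\mathrm{Mat}_n(B(\mathcal H))$ be obtained by evaluating every entry at $\mathbf{X}=\Xi$. Equip the $C^*$-algebra $\mathrm{Mat}_n(B(\mathcal H))$ with the state $\phi_n(A)=\frac1n\sum_{i=1}^n\phi(A(i,i))$. If $f$ is self-adjoint, let $\mu_f$ be the law of $f(\Xi)$, i.e. the unique Borel probability measure on $\mathbb{R}$ carried by the spectrum $\mathrm{Spec}(f(\Xi))\subset\mathbb{R}$ with $\phi_n(g(f(\Xi)))=\int g\,d\mu_f$ for every continuous $g:\mathrm{Spec}(f(\Xi))\to\mathbb{C}$, where $g(f(\Xi))$ is defined by the continuous functional calculus. Then for every $n\ge1$ and every self-adjoint $f\in\mathrm{Mat}_n(\mathbb{C}\langle\mathbf{X}\rangle)$, $$\mathrm{supp}\,\mu_f=\mathrm{Spec}(f(\Xi)).$$ -/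

import Mathlib

noncomputable section

open scoped ComplexOrder ComplexConjugate InnerProductSpace

/-! ### The noncommutative polynomial `*`-algebra -/

/-- The noncommutative polynomial algebra `ℂ⟨X⟩` in variables `X_1, X_2, …`: its elements are the
finite complex linear combinations of words in the positive integers. -/
abbrev NCPoly : Type := MonoidAlgebra ℂ (FreeMonoid ℕ+)

namespace NCPoly

/-- The variable `X_ℓ`. -/
def X (l : ℕ+) : NCPoly := MonoidAlgebra.single (FreeMonoid.of l) 1

/-- The involution of `ℂ⟨X⟩`: conjugate the coefficients and reverse the words. -/
instance instStar : Star NCPoly where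
  star p := MonoidAlgebra.ofCoeff
    ((p.coeff.mapRange conj (map_zero _)).mapDomain (star : FreeMonoid ℕ+ → FreeMonoid ℕ+))

theorem star_single (w : FreeMonoid ℕ+) (c : ℂ) :
    star (MonoidAlgebra.single w c : NCPoly) = MonoidAlgebra.single (star w) (conj c) := by
  show MonoidAlgebra.ofCoeff _ = _
  rw [MonoidAlgebra.coeff_single, Finsupp.mapRange_single, Finsupp.mapDomain_single,
    MonoidAlgebra.ofCoeff_single]

theorem star_zero' : star (0 : NCPoly) = 0 := by
  show MonoidAlgebra.ofCoeff _ = _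
  rw [MonoidAlgebra.coeff_zero, Finsupp.mapRange_zero, Finsupp.mapDomain_zero,
    MonoidAlgebra.ofCoeff_zero]

theorem star_add' (p q : NCPoly) : star (p + q) = star p + star q := by
  show MonoidAlgebra.ofCoeff _ = MonoidAlgebra.ofCoeff _ + MonoidAlgebra.ofCoeff _
  rw [MonoidAlgebra.coeff_add, ← MonoidAlgebra.ofCoeff_add, Finsupp.mapRange_add (by simp),
    Finsupp.mapDomain_add]

instance instStarRing : StarRing NCPoly where
  star_involutive p := by
    induction p using MonoidAlgebra.induction_linear with
    | zero => rw [star_zero', star_zero']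
    | add p q hp hq => rw [star_add', star_add', hp, hq]
    | single w c => simp [star_single]
  star_add := star_add'
  star_mul p q := by
    induction p using MonoidAlgebra.induction_linear with
    | zero => simp [star_zero']
    | add p p' hp hp' => rw [add_mul, star_add', star_add', hp, hp', mul_add]
    | single w c =>
      induction q using MonoidAlgebra.induction_linear with
      | zero => simp [star_zero']
      | add q q' hq hq' => rw [mul_add, star_add', star_add', hq, hq', add_mul]
      | single w' c' => simp [star_single, MonoidAlgebra.single_mul_single, mul_comm]

/-- All the variables are self-adjoint. -/
theorem star_X (l : ℕ+) : star (X l) = X l := by simp [X, star_single]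

/-- Scalars are conjugated. -/
theorem star_smul' (c : ℂ) (p : NCPoly) : star (c • p) = conj c • star p := by
  induction p using MonoidAlgebra.induction_linear with
  | zero => simp
  | add p q hp hq => simp [hp, hq]
  | single w d => simp [star_single, MonoidAlgebra.smul_single]

/-- Evaluation of noncommutative polynomials at a sequence in an algebra. -/
def eval {A : Type*} [Ring A] [Algebra ℂ A] (a : ℕ+ → A) : NCPoly →ₐ[ℂ] A :=
  MonoidAlgebra.lift ℂ A (FreeMonoid ℕ+) (FreeMonoid.lift a)

theorem eval_X {A : Type*} [Ring A] [Algebra ℂ A] (a : ℕ+ → A) (l : ℕ+) :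
    eval a (X l) = a l := by simp [eval, X]

theorem eval_star {A : Type*} [Ring A] [StarRing A] [Algebra ℂ A] [StarModule ℂ A] (a : ℕ+ → A)
    (ha : ∀ l, IsSelfAdjoint (a l)) (p : NCPoly) : eval a (star p) = star (eval a p) := by
  have hw : ∀ w : FreeMonoid ℕ+, FreeMonoid.lift a (star w) = star (FreeMonoid.lift a w) := by
    intro w
    induction w using FreeMonoid.inductionOn' with
    | one => simp
    | of_mul l w ih => simp [ih, (ha l).star_eq]
  induction p using MonoidAlgebra.induction_linear with
  | zero => simp
  | add p q hp hq => simp [hp, hq]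
  | single w d => simp [star_single, eval, hw, star_smul]

/-- Entrywise evaluation `f ↦ f(a)` from `Mat_n(ℂ⟨X⟩)` to `Mat_n(A)`. -/
def evalMatrix {n : ℕ} {A : Type*} [Ring A] [Algebra ℂ A] (a : ℕ+ → A)
    (f : Matrix (Fin n) (Fin n) NCPoly) : CStarMatrix (Fin n) (Fin n) A :=
  CStarMatrix.ofMatrix (f.map (eval a))

theorem isSelfAdjoint_evalMatrix {n : ℕ} {A : Type*} [Ring A] [StarRing A] [Algebra ℂ A]
    [StarModule ℂ A] (a : ℕ+ → A) (ha : ∀ l, IsSelfAdjoint (a l))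
    {f : Matrix (Fin n) (Fin n) NCPoly} (hf : IsSelfAdjoint f) :
    IsSelfAdjoint (evalMatrix a f) := by
  have h : ∀ i j, star (f j i) = f i j := fun i j => congrFun (congrFun hf i) j
  ext i j
  show star (eval a (f j i)) = eval a (f i j)
  rw [← eval_star a ha, h]

end NCPoly

/-! ### States and laws -/

/-- A state on a unital C⋆-algebra: a positive linear functional of value `1` at the unit. -/
structure CStarState (A : Type*) [CStarAlgebra A] where
  toFun : A →ₗ[ℂ] ℂ
  nonneg : ∀ a : A, 0 ≤ toFun (star a * a)
  map_one : toFun 1 = 1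

instance (A : Type*) [CStarAlgebra A] : CoeFun (CStarState A) (fun _ => A → ℂ) :=
  ⟨fun φ => φ.toFun⟩

/-- `μ` is the law of the self-adjoint element `a` in the C⋆-probability space `(A, φ)`: a Borel
probability measure on the real line, carried by `Spec(a)`, with `φ(g(a)) = ∫ g dμ` for every
continuous complex-valued `g` on `Spec(a)`, where `g(a)` is the continuous functional calculus. -/
structure IsLaw {A : Type*} [CStarAlgebra A] (φ : CStarState A) (a : A)
    (μ : MeasureTheory.Measure ℝ) : Prop where
  isProbabilityMeasure : MeasureTheory.IsProbabilityMeasure μ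
  carried : μ {x : ℝ | (x : ℂ) ∉ spectrum ℂ a} = 0
  integral_eq : ∀ g : ℂ → ℂ, ContinuousOn g (spectrum ℂ a) →
    φ (cfc g a) = ∫ x : ℝ, g x ∂μ

section Law

open MeasureTheory

variable {A : Type*} [CStarAlgebra A] (φ : CStarState A) {a : A}

theorem IsLaw.unique {μ ν : Measure ℝ} (hμ : IsLaw φ a μ)
    (hν : IsLaw φ a ν) : μ = ν := by
  have := hμ.isProbabilityMeasure
  have := hν.isProbabilityMeasure
  refine ext_of_forall_integral_eq_of_IsFiniteMeasure fun g => ?_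
  have hc : ContinuousOn (fun z : ℂ => ((g z.re : ℝ) : ℂ)) (spectrum ℂ a) := by fun_prop
  have h := (hμ.integral_eq _ hc).symm.trans (hν.integral_eq _ hc)
  simp only [Complex.ofReal_re] at h
  have e : ∀ ρ : Measure ℝ, ∫ x, ((g x : ℝ) : ℂ) ∂ρ = ((∫ x, g x ∂ρ : ℝ) : ℂ) :=
    fun ρ => integral_ofReal
  rw [e, e] at h
  exact_mod_cast h

theorem exists_isLaw (ha : IsSelfAdjoint a) : ∃ μ : Measure ℝ, IsLaw φ a μ := by
  have hn : IsStarNormal a := ha.isStarNormal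
  let X := spectrum ℂ a
  have hX : CompactSpace X := isCompact_iff_compactSpace.mp (spectrum.isCompact a)
  have hre : ∀ z : X, (((z : ℂ).re : ℝ) : ℂ) = z := fun z => (ha.mem_spectrum_eq_re z.2).symm
  let C : C(X, ℝ) → C(X, ℂ) := fun g => ⟨fun x => (g x : ℂ), by fun_prop⟩
  let ψ : C(X, ℂ) →ₗ[ℂ] ℂ := φ.toFun ∘ₗ (cfcHom (R := ℂ) hn).toAlgHom.toLinearMap
  have hψ : ∀ g, ψ g = φ (cfcHom hn g) := fun _ => rfl
  have hpos : ∀ g : C(X, ℝ), 0 ≤ g → 0 ≤ ψ (C g) := by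
    intro g hg
    let s : C(X, ℝ) := ⟨fun x => Real.sqrt (g x), by fun_prop⟩
    have hs : C g = star (C s) * C s := by
      ext x
      have : Real.sqrt (g x) * Real.sqrt (g x) = g x := Real.mul_self_sqrt (hg x)
      simp [C, s, ← Complex.ofReal_mul, this]
    rw [hψ, hs, map_mul, map_star]
    exact φ.nonneg _
  have hadd : ∀ g h, C (g + h) = C g + C h := fun g h => by ext x; simp [C]
  have hsmul : ∀ (r : ℝ) g, C (r • g) = (r : ℂ) • C g := fun g h => by ext x; simp [C]
  have him : ∀ g : C(X, ℝ), ((ψ (C g)).re : ℂ) = ψ (C g) := by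
    intro g
    have h1 := hpos (g ⊔ 0) le_sup_right
    have h2 := hpos ((-g) ⊔ 0) le_sup_right
    have hg : C g = C (g ⊔ 0) - C ((-g) ⊔ 0) := by
      ext x
      have : g x = max (g x) 0 - max (-g x) 0 := by
        rcases le_total 0 (g x) with h | h <;> simp [h]
      simp [C, ← Complex.ofReal_sub, ← this]
    rw [Complex.nonneg_iff] at h1 h2
    apply Complex.ext
    · simp
    · simp [hg, ← h1.2, ← h2.2]
  let Λ₀ : CompactlySupportedContinuousMap X ℝ →ₗ[ℝ] ℝ :=
    { toFun := fun g => (ψ (C g.toContinuousMap)).re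
      map_add' := fun g h => by
        have : (g + h).toContinuousMap = g.toContinuousMap + h.toContinuousMap := rfl
        rw [this, hadd, map_add, Complex.add_re]
      map_smul' := fun r g => by
        have : (r • g).toContinuousMap = r • g.toContinuousMap := rfl
        rw [this, hsmul, map_smul]
        simp }
  let Λ : CompactlySupportedContinuousMap X ℝ →ₚ[ℝ] ℝ :=
    PositiveLinearMap.mk₀ Λ₀ fun g hg => (Complex.nonneg_iff.mp (hpos _ hg)).1
  let ν := RealRMK.rieszMeasure Λ
  have hfin : IsFiniteMeasure ν := by infer_instance
  have hν : ∀ g : C(X, ℝ), ψ (C g) = ((∫ x, g x ∂ν : ℝ) : ℂ) := by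
    intro g
    let g' : CompactlySupportedContinuousMap X ℝ :=
      ⟨g, HasCompactSupport.of_compactSpace _⟩
    have h := RealRMK.integral_rieszMeasure Λ g'
    have h2 : Λ g' = (ψ (C g)).re := rfl
    rw [← him, ← h2, ← h]
    rfl
  have hνc : ∀ g : C(X, ℂ), ψ g = ∫ x, g x ∂ν := by
    intro g
    let u : C(X, ℝ) := ⟨fun x => (g x).re, by fun_prop⟩
    let v : C(X, ℝ) := ⟨fun x => (g x).im, by fun_prop⟩
    have hg : g = C u + Complex.I • C v := by
      ext x
      simp only [C, u, v, ContinuousMap.add_apply, ContinuousMap.smul_apply,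
        ContinuousMap.coe_mk, smul_eq_mul]
      rw [mul_comm, Complex.re_add_im]
    have hi : Integrable g ν := g.continuous.integrable_of_hasCompactSupport
      (HasCompactSupport.of_compactSpace _)
    conv_lhs => rw [hg]
    rw [map_add, map_smul, hν, hν, ← integral_re_add_im hi]
    simp [u, v, mul_comm]
  have hm : Measurable (fun z : X => (z : ℂ).re) := by fun_prop
  have hone : ψ 1 = 1 := by rw [hψ, map_one]; exact φ.map_one
  refine ⟨ν.map fun z : X => (z : ℂ).re, ?_, ?_, ?_⟩
  · have h1 : ν.real Set.univ = 1 := by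
      have h := hνc 1
      rw [hone] at h
      simp at h
      exact_mod_cast h.symm
    constructor
    rw [Measure.map_apply hm MeasurableSet.univ, Set.preimage_univ]
    rw [measureReal_def] at h1
    exact (ENNReal.toReal_eq_one_iff _).mp h1
  · have hms : MeasurableSet {x : ℝ | (x : ℂ) ∉ spectrum ℂ a} :=
      ((spectrum.isClosed a).preimage Complex.continuous_ofReal).isOpen_compl.measurableSet
    rw [Measure.map_apply hm hms]
    convert measure_empty (μ := ν)
    ext z
    simp [hre]
  · intro g hg
    have he : ∀ z : X, g (((z : ℂ).re : ℝ) : ℂ) = g z := fun z => by rw [hre]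
    rw [cfc_apply g a hn hg, ← hψ, hνc]
    have hms : MeasurableEmbedding (fun z : X => (z : ℂ).re) := by
      refine Topology.IsClosedEmbedding.measurableEmbedding ?_
      refine Continuous.isClosedEmbedding (by fun_prop) fun z w h => ?_
      apply Subtype.ext
      rw [← hre z, ← hre w]
      exact congrArg _ h
    rw [hms.integral_map]
    simp only [he]
    rfl

/-- The law `μ_a` of a self-adjoint element `a` of a C⋆-probability space: the unique measure
satisfying `IsLaw` (see `isLaw_law` and `IsLaw.unique`). -/
def law (ha : IsSelfAdjoint a) : Measure ℝ := (exists_isLaw φ ha).choose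

theorem isLaw_law (ha : IsSelfAdjoint a) : IsLaw φ a (law φ ha) := (exists_isLaw φ ha).choose_spec

end Law

/-- The state `φ_n(A) = (1/n) ∑ i, φ(A(i,i))` on `Mat_n(A)`. -/
def CStarState.matrix {A : Type*} [CStarAlgebra A] [PartialOrder A] [StarOrderedRing A]
    (φ : CStarState A) (n : ℕ) [NeZero n] : CStarState (CStarMatrix (Fin n) (Fin n) A) where
  toFun :=
    { toFun := fun M => (n : ℂ)⁻¹ * ∑ i, φ (M i i)
      map_add' := fun M N => by
        simp [CStarMatrix.add_apply, Finset.sum_add_distrib, mul_add]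
      map_smul' := fun c M => by
        simp only [CStarMatrix.smul_apply, map_smul, smul_eq_mul, RingHom.id_apply,
          ← Finset.mul_sum]
        ring }
  nonneg M := by
    show 0 ≤ (n : ℂ)⁻¹ * ∑ i, φ ((star M * M) i i)
    refine mul_nonneg (by positivity) (Finset.sum_nonneg fun i _ => ?_)
    rw [CStarMatrix.mul_apply, map_sum]
    exact Finset.sum_nonneg fun j _ => φ.nonneg (M j i)
  map_one := by
    show (n : ℂ)⁻¹ * ∑ i : Fin n, φ ((1 : CStarMatrix (Fin n) (Fin n) A) i i) = 1
    simp [CStarMatrix.one_apply_eq, φ.map_one, NeZero.ne n]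

/-! ### Boltzmann–Fock space -/

namespace BoltzmannFock

/-- The Hilbert space with orthonormal basis indexed by finite sequences of positive integers. -/
abbrev H : Type := lp (fun _ : List ℕ+ => ℂ) 2

/-- The orthonormal basis vector `v(i_1 ⋯ i_k)`. -/
def v (w : List ℕ+) : H := lp.single 2 w 1

theorem orthonormal_v : Orthonormal ℂ v := by
  rw [orthonormal_iff_ite]
  intro w w'
  simp only [v]
  rw [lp.inner_single_left, lp.single_apply]
  by_cases h : w = w' <;> simp [h]

/-- The vacuum vector `1_H = v(∅)`. -/
def vacuum : H := v []

/-- The vacuum state `A ↦ (1_H, A 1_H)` on `B(H)`. -/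
def vacuumState : CStarState (H →L[ℂ] H) where
  toFun :=
    { toFun := fun T => ⟪vacuum, T vacuum⟫_ℂ
      map_add' := fun S T => by simp
      map_smul' := fun c T => by simp }
  nonneg T := by
    show 0 ≤ ⟪vacuum, (star T * T) vacuum⟫_ℂ
    rw [ContinuousLinearMap.star_eq_adjoint, mul_apply_eq_comp,
      ContinuousLinearMap.adjoint_inner_right]
    rw [inner_self_eq_norm_sq_to_K]
    exact pow_nonneg (RCLike.ofReal_nonneg.mpr (norm_nonneg _)) 2
  map_one := by
    show ⟪vacuum, vacuum⟫_ℂ = 1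
    rw [inner_self_eq_norm_sq_to_K, vacuum, orthonormal_v.1]
    simp

/-- The raising operator `Σ_i`, the isometry with `Σ_i v(w) = v(i w)` (see `raising_v`). -/
def raising (i : ℕ+) : H →L[ℂ] H :=
  ((orthonormal_v.comp (fun w => i :: w)
    List.cons_injective).orthogonalFamily.linearIsometry).toContinuousLinearMap

theorem raising_v (i : ℕ+) (w : List ℕ+) : raising i (v w) = v (i :: w) := by
  show (orthonormal_v.comp (fun w => i :: w)
    List.cons_injective).orthogonalFamily.linearIsometry (lp.single 2 w 1) = _
  rw [OrthogonalFamily.linearIsometry_apply_single]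
  simp

/-- The semicircular variables `Ξ_ℓ = i^ℓ Σ_ℓ + i^{-ℓ} Σ_ℓ^*`. -/
def Xi (l : ℕ+) : H →L[ℂ] H :=
  Complex.I ^ (l : ℕ) • raising l + Complex.I ^ (-(l : ℤ)) • star (raising l)

theorem isSelfAdjoint_Xi (l : ℕ+) : IsSelfAdjoint (Xi l) := by
  have h : star (Complex.I ^ (l : ℕ)) = Complex.I ^ (-(l : ℤ)) := by
    simp [star_pow, zpow_neg, ← inv_pow]
  have h' : star (Complex.I ^ (-(l : ℤ))) = Complex.I ^ (l : ℕ) := by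
    rw [← h, star_star]
  rw [IsSelfAdjoint, Xi, star_add, star_smul, star_smul, h, h', star_star, add_comm]

/-- The measure `μ_f`: the law of `f(Ξ)` in `(Mat_n(B(H)), φ_n)`, where `φ` is the vacuum state. -/
def mu {n : ℕ} [NeZero n] (f : Matrix (Fin n) (Fin n) NCPoly) (hf : IsSelfAdjoint f) :
    MeasureTheory.Measure ℝ :=
  law (vacuumState.matrix n) (NCPoly.isSelfAdjoint_evalMatrix Xi isSelfAdjoint_Xi hf)

end BoltzmannFock

end

open scoped ComplexOrder ComplexConjugate InnerProductSpace

/-! A law is carried by the closed set $\mathrm{Spec}(a)$, so its support lies there. The reverse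
inclusion needs the state to be faithful on the functional calculus of $a$: a bump $g$ at a spectral
point outside the support gives $\phi(g(a)^*g(a))=\int|g|^2\,d\mu=0$, hence $g(a)=0$, so $g$
vanishes on the spectrum, a contradiction (`IsLaw.ofReal_image_support_eq`).

The vacuum state is not faithful on $B(\mathcal H)$, since each $\Sigma_\ell^*$ kills the vacuum.
What saves the argument is that left and right creation nearly commute: the operators `rightXi`,
which add or remove letters at the right end of a word, commute with every $\Xi_\ell$
(`commute_Xi_rightXi`), and they generate all basis vectors from the vacuum
(`exists_commute_Xi_apply_vacuum`). The vacuum is thus cyclic for the commutant of the $\Xi_\ell$,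
hence separating for the bicommutant, where the entries of $g(f(\Xi))$ lie. -/

theorem NCPoly.commute_eval {A : Type*} [Ring A] [Algebra ℂ A] {a : ℕ+ → A} {b : A}
    (h : ∀ l, Commute (a l) b) (p : NCPoly) : Commute (eval a p) b := by
  have hw : ∀ w : FreeMonoid ℕ+, Commute (FreeMonoid.lift a w) b := by
    intro w
    induction w using FreeMonoid.inductionOn' with
    | one => simp
    | of_mul l w ih => simpa using (h l).mul_left ih
  induction p using MonoidAlgebra.induction_linear with
  | zero => simp
  | add p q hp hq => simpa using hp.add_left hq
  | single w d => simpa [eval] using (hw w).smul_left d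

/-- A matrix commutes with the scalar matrix of `b` if and only if its entries commute with `b`. -/
theorem CStarMatrix.commute_diagonal_iff {n : Type*} [Fintype n] [DecidableEq n] {A : Type*}
    [Ring A] (M : CStarMatrix n n A) (b : A) :
    Commute M (CStarMatrix.ofMatrix (Matrix.diagonal fun _ => b)) ↔ ∀ i j, Commute (M i j) b := by
  have hl : ∀ i j, (M * CStarMatrix.ofMatrix (Matrix.diagonal fun _ => b) :
      CStarMatrix n n A) i j = M i j * b :=
    fun i j => Matrix.mul_diagonal (fun _ => b) (CStarMatrix.ofMatrix.symm M) i j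
  have hr : ∀ i j, (CStarMatrix.ofMatrix (Matrix.diagonal fun _ => b) * M :
      CStarMatrix n n A) i j = b * M i j :=
    fun i j => Matrix.diagonal_mul (fun _ => b) (CStarMatrix.ofMatrix.symm M) i j
  refine ⟨fun h i j => ?_, fun h => ?_⟩
  · rw [Commute, SemiconjBy, ← hl, ← hr, h.eq]
  · ext i j
    rw [hl, hr, (h i j).eq]

/-! ### Support of a law and faithfulness -/

section Law

open MeasureTheory

variable {A : Type*} [CStarAlgebra A] {φ : CStarState A} {a : A} {μ : Measure ℝ}

theorem IsLaw.ofReal_image_support_subset (hμ : IsLaw φ a μ) :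
    Complex.ofReal '' μ.support ⊆ spectrum ℂ a := by
  rintro _ ⟨x, hx, rfl⟩
  have hcl : IsClosed {x : ℝ | (x : ℂ) ∈ spectrum ℂ a} :=
    (spectrum.isClosed a).preimage Complex.continuous_ofReal
  exact Measure.support_subset_of_isClosed hcl (mem_ae_iff.mpr hμ.carried) hx

/-- If the state is faithful on the functional calculus of `a`, then the law of `a` charges every
neighbourhood of a point of the spectrum. -/
theorem IsLaw.ofReal_image_support_eq (ha : IsSelfAdjoint a) (hμ : IsLaw φ a μ)
    (hφ : ∀ g : ℂ → ℂ, φ (star (cfc g a) * cfc g a) = 0 → cfc g a = 0) :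
    Complex.ofReal '' μ.support = spectrum ℂ a := by
  refine hμ.ofReal_image_support_subset.antisymm fun z hz => ?_
  refine ⟨z.re, ?_, (ha.mem_spectrum_eq_re hz).symm⟩
  by_contra hx
  obtain ⟨U, hU, hμU⟩ := Measure.notMem_support_iff_exists.mp hx
  obtain ⟨ε, hε, hball⟩ := Metric.mem_nhds_iff.mp hU
  have hn : IsStarNormal a := ha.isStarNormal
  -- A tent of height `ε` at `z`, zero as soon as the real part leaves the ball inside the null set
  -- `U`.
  let g : ℂ → ℂ := fun w => ((max 0 (ε - dist w.re z.re) : ℝ) : ℂ)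
  have hg : ContinuousOn g (spectrum ℂ a) := by fun_prop
  have hstar : star (cfc g a) * cfc g a = cfc (fun w => star (g w) * g w) a := by
    rw [← cfc_star, ← cfc_mul _ _ a (by fun_prop) hg]
  have hint : φ (star (cfc g a) * cfc g a) = 0 := by
    rw [hstar, hμ.integral_eq _ (by fun_prop)]
    refine integral_eq_zero_of_ae ?_
    have hae : Uᶜ ∈ ae μ := by rwa [mem_ae_iff, compl_compl]
    filter_upwards [hae] with x hxU
    have hd : ε ≤ dist x z.re := not_lt.mp fun h => hxU (hball h)
    simp [g, max_eq_left (sub_nonpos.mpr hd)]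
  have h0 : cfc g a = cfc (fun _ => (0 : ℂ)) a := by rw [hφ g hint]; simp
  have hz0 : g z = 0 := eqOn_of_cfc_eq_cfc h0 hg (by fun_prop) hn hz
  simp [g, max_eq_right hε.le, hε.ne'] at hz0

end Law

/-! ### Left and right creation operators on words -/

namespace BoltzmannFock

theorem inner_v (w u : List ℕ+) : ⟪v w, v u⟫_ℂ = if w = u then 1 else 0 :=
  orthonormal_iff_ite.mp orthonormal_v w u

theorem ext_inner_v {x y : H} (h : ∀ w, ⟪v w, x⟫_ℂ = ⟪v w, y⟫_ℂ) : x = y := by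
  ext w
  simpa [v, lp.inner_single_left] using h w

theorem operator_ext {S T : H →L[ℂ] H} (h : ∀ w, S (v w) = T (v w)) : S = T := by
  refine lp.ext_continuousLinearMap (by simp) fun w => ?_
  ext
  exact congrArg (fun x : H => (x : List ℕ+ → ℂ) _) (h w)

theorem star_raising_v_nil (i : ℕ+) : star (raising i) (v []) = 0 := by
  refine ext_inner_v fun w => ?_
  rw [ContinuousLinearMap.star_eq_adjoint, ContinuousLinearMap.adjoint_inner_right, raising_v,
    inner_v]
  simp

theorem star_raising_v_cons (i j : ℕ+) (w : List ℕ+) :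
    star (raising i) (v (j :: w)) = if i = j then v w else 0 := by
  refine ext_inner_v fun u => ?_
  rw [ContinuousLinearMap.star_eq_adjoint, ContinuousLinearMap.adjoint_inner_right, raising_v,
    inner_v]
  by_cases hij : i = j
  · rw [if_pos hij, inner_v]
    simp [hij]
  · rw [if_neg hij, inner_zero_right]
    simp [hij]

theorem append_singleton_injective (i : ℕ+) : Function.Injective fun w : List ℕ+ => w ++ [i] :=
  List.append_left_injective [i]

/-- The right raising operator, the isometry with `v(w) ↦ v(w i)`. -/
noncomputable def rightRaising (i : ℕ+) : H →L[ℂ] H :=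
  ((orthonormal_v.comp (fun w => w ++ [i])
    (append_singleton_injective i)).orthogonalFamily.linearIsometry).toContinuousLinearMap

theorem rightRaising_v (i : ℕ+) (w : List ℕ+) : rightRaising i (v w) = v (w ++ [i]) := by
  show (orthonormal_v.comp (fun w => w ++ [i])
    (append_singleton_injective i)).orthogonalFamily.linearIsometry (lp.single 2 w 1) = _
  rw [OrthogonalFamily.linearIsometry_apply_single]
  simp

theorem star_rightRaising_v_nil (i : ℕ+) : star (rightRaising i) (v []) = 0 := by
  refine ext_inner_v fun w => ?_
  rw [ContinuousLinearMap.star_eq_adjoint, ContinuousLinearMap.adjoint_inner_right,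
    rightRaising_v, inner_v]
  simp

theorem star_rightRaising_v_append (i j : ℕ+) (w : List ℕ+) :
    star (rightRaising i) (v (w ++ [j])) = if i = j then v w else 0 := by
  refine ext_inner_v fun u => ?_
  rw [ContinuousLinearMap.star_eq_adjoint, ContinuousLinearMap.adjoint_inner_right,
    rightRaising_v, inner_v]
  by_cases hij : i = j
  · rw [if_pos hij, inner_v]
    simp [hij]
  · rw [if_neg hij, inner_zero_right]
    simp [hij]

/-- The right-handed semicircular variables, which commute with all the `Ξ_m`. -/
noncomputable def rightXi (l : ℕ+) : H →L[ℂ] H :=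
  Complex.I ^ (l : ℕ) • rightRaising l + Complex.I ^ (-(l : ℤ)) • star (rightRaising l)

theorem Xi_apply (l : ℕ+) (x : H) : Xi l x =
    Complex.I ^ (l : ℕ) • raising l x + Complex.I ^ (-(l : ℤ)) • star (raising l) x := rfl

theorem rightXi_apply (l : ℕ+) (x : H) : rightXi l x =
    Complex.I ^ (l : ℕ) • rightRaising l x + Complex.I ^ (-(l : ℤ)) • star (rightRaising l) x :=
  rfl

/-- This and the next three lemmas restate the action on a last letter for the shapes in which
`simp` meets words, where leading letters hide the pattern `w ++ [j]`. -/
theorem star_rightRaising_v_singleton (i j : ℕ+) :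
    star (rightRaising i) (v [j]) = if i = j then v [] else 0 :=
  star_rightRaising_v_append i j []

theorem star_rightRaising_v_cons_append (i j k : ℕ+) (w : List ℕ+) :
    star (rightRaising i) (v (k :: (w ++ [j]))) = if i = j then v (k :: w) else 0 :=
  star_rightRaising_v_append i j (k :: w)

theorem star_rightRaising_v_pair (i j k : ℕ+) :
    star (rightRaising i) (v [k, j]) = if i = j then v [k] else 0 :=
  star_rightRaising_v_append i j [k]

theorem star_rightRaising_v_cons_cons_append (i j k l : ℕ+) (w : List ℕ+) :
    star (rightRaising i) (v (k :: l :: (w ++ [j]))) = if i = j then v (k :: l :: w) else 0 :=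
  star_rightRaising_v_append i j (k :: l :: w)

/-- Operations at opposite ends of a word commute, except that on the vacuum a letter created at one
end can be annihilated at the other. This happens only for `l = m`, and the two orders then both
contribute the vacuum with coefficient $\mathrm i^{l}\mathrm i^{-l}=1$, so they cancel. -/
theorem commute_Xi_rightXi (l m : ℕ+) : Commute (Xi l) (rightXi m) := by
  refine operator_ext fun w => ?_
  show Xi l (rightXi m (v w)) = rightXi m (Xi l (v w))
  -- One-letter words form a separate case, because their first and last letters are the same one.
  rcases w with _ | ⟨j, w⟩
  · by_cases h : l = m
    · subst h
      simp [Xi_apply, rightXi_apply, raising_v, rightRaising_v, star_raising_v_nil,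
        star_raising_v_cons, star_rightRaising_v_nil, star_rightRaising_v_singleton, smul_smul]
    · simp [Xi_apply, rightXi_apply, raising_v, rightRaising_v, star_raising_v_nil,
        star_raising_v_cons, star_rightRaising_v_nil, star_rightRaising_v_singleton, smul_smul,
        mul_comm, h, Ne.symm h]
  · rcases List.eq_nil_or_concat w with rfl | ⟨w, k, rfl⟩
    · by_cases h : l = j <;> by_cases h' : m = j <;>
      simp [Xi_apply, rightXi_apply, raising_v, rightRaising_v, star_raising_v_nil,
        star_raising_v_cons, star_rightRaising_v_nil, star_rightRaising_v_singleton,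
        star_rightRaising_v_pair, smul_smul, h, h'] <;> module
    · by_cases h : l = j <;> by_cases h' : m = k <;>
      simp [Xi_apply, rightXi_apply, raising_v, rightRaising_v,
        star_raising_v_cons, star_rightRaising_v_cons_append, star_rightRaising_v_append,
        star_rightRaising_v_cons_cons_append, smul_smul, h, h'] <;> module

/-- The vacuum is cyclic for the commutant of the `Ξ_l`. -/
theorem exists_commute_Xi_apply_vacuum (w : List ℕ+) :
    ∃ S : H →L[ℂ] H, (∀ l, Commute (Xi l) S) ∧ S vacuum = v w := by
  -- Strong induction, since annihilating a letter of `u` leaves a word two letters shorter than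
  -- `w`.
  induction hk : w.length using Nat.strong_induction_on generalizing w with
  | _ k ih =>
    subst hk
    rcases List.eq_nil_or_concat w with rfl | ⟨u, m, rfl⟩
    · exact ⟨1, fun l => Commute.one_right _, rfl⟩
    obtain ⟨S, hS, hSv⟩ := ih u.length (by simp) u rfl
    -- `rightXi m` sends $v(u)$ to $\mathrm i^m v(um)$ plus an annihilation term, which is zero or a
    -- multiple of a shorter basis vector; `T` produces that term so that it can be subtracted.
    obtain ⟨T, hT, hTv⟩ : ∃ T : H →L[ℂ] H, (∀ l, Commute (Xi l) T) ∧
        T vacuum = star (rightRaising m) (v u) := by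
      rcases List.eq_nil_or_concat u with rfl | ⟨t, k, rfl⟩
      · exact ⟨0, fun l => Commute.zero_right _, by rw [star_rightRaising_v_nil]; rfl⟩
      obtain ⟨T, hT, hTv⟩ := ih t.length (by simp) t rfl
      rw [List.concat_eq_append, star_rightRaising_v_append]
      split_ifs
      · exact ⟨T, hT, hTv⟩
      · exact ⟨0, fun l => Commute.zero_right _, rfl⟩
    refine ⟨(Complex.I ^ (m : ℕ))⁻¹ • (rightXi m * S - Complex.I ^ (-(m : ℤ)) • T), fun l =>
      ((((commute_Xi_rightXi l m).mul_right (hS l)).sub_right ((hT l).smul_right _)).smul_right _),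
      ?_⟩
    have hI : Complex.I ^ (m : ℕ) ≠ 0 := pow_ne_zero _ Complex.I_ne_zero
    show (Complex.I ^ (m : ℕ))⁻¹ •
      (rightXi m (S vacuum) - Complex.I ^ (-(m : ℤ)) • T vacuum) = _
    rw [hSv, hTv, rightXi_apply, add_sub_cancel_right, rightRaising_v, inv_smul_smul₀ hI,
      List.concat_eq_append]

/-- The vacuum is separating for the bicommutant of the `Ξ_l`. -/
theorem eq_zero_of_apply_vacuum_eq_zero {T : H →L[ℂ] H}
    (hT : ∀ S : H →L[ℂ] H, (∀ l, Commute (Xi l) S) → Commute T S) (h : T vacuum = 0) : T = 0 := by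
  refine operator_ext fun w => ?_
  obtain ⟨S, hS, hSv⟩ := exists_commute_Xi_apply_vacuum w
  have hc : T (S vacuum) = S (T vacuum) := congrArg (fun R : H →L[ℂ] H => R vacuum) (hT S hS).eq
  rw [← hSv, hc, h, map_zero]
  rfl

/-! ### Faithfulness of the matrix state -/

theorem vacuumState_star_mul_self (T : H →L[ℂ] H) :
    vacuumState (star T * T) = ((‖T vacuum‖ ^ 2 : ℝ) : ℂ) := by
  show ⟪vacuum, (star T * T) vacuum⟫_ℂ = _
  rw [ContinuousLinearMap.star_eq_adjoint, mul_apply_eq_comp,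
    ContinuousLinearMap.adjoint_inner_right, inner_self_eq_norm_sq_to_K]
  simp

/-- The value of the state is $\frac1n\sum_{i,j}\|M(i,j)1_{\mathcal H}\|^2$, a sum of nonnegative
terms. -/
theorem apply_vacuum_eq_zero_of_matrix {n : ℕ} [NeZero n]
    {M : CStarMatrix (Fin n) (Fin n) (H →L[ℂ] H)} (hM : vacuumState.matrix n (star M * M) = 0)
    (i j : Fin n) : M i j vacuum = 0 := by
  have h : (n : ℂ)⁻¹ * ∑ j, vacuumState ((star M * M) j j) = 0 := hM
  have he : ∀ j, vacuumState ((star M * M) j j) = ((∑ i, ‖M i j vacuum‖ ^ 2 : ℝ) : ℂ) := by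
    intro j
    rw [CStarMatrix.mul_apply, map_sum, Complex.ofReal_sum]
    exact Finset.sum_congr rfl fun i _ => vacuumState_star_mul_self (M i j)
  simp only [he, mul_eq_zero, inv_eq_zero, Nat.cast_eq_zero, NeZero.ne n, false_or] at h
  rw [← Complex.ofReal_sum, Complex.ofReal_eq_zero] at h
  have h1 := (Finset.sum_eq_zero_iff_of_nonneg fun j _ => by positivity).mp h j (Finset.mem_univ j)
  have h2 := (Finset.sum_eq_zero_iff_of_nonneg fun i _ => by positivity).mp h1 i
    (Finset.mem_univ i)
  simpa using h2

/-- The state `φ_n` is faithful on the functional calculus of `f(Ξ)`. -/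
theorem cfc_evalMatrix_eq_zero {n : ℕ} [NeZero n] {f : Matrix (Fin n) (Fin n) NCPoly}
    (hf : IsSelfAdjoint f) (g : ℂ → ℂ)
    (h : vacuumState.matrix n (star (cfc g (NCPoly.evalMatrix Xi f)) *
      cfc g (NCPoly.evalMatrix Xi f)) = 0) :
    cfc g (NCPoly.evalMatrix Xi f) = 0 := by
  have ha := NCPoly.isSelfAdjoint_evalMatrix Xi isSelfAdjoint_Xi hf
  ext1 i j
  refine eq_zero_of_apply_vacuum_eq_zero (fun S hS => ?_) (apply_vacuum_eq_zero_of_matrix h i j)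
  -- Commutation of all entries with `S` is commutation with one scalar matrix, a property that
  -- passes from $f(\Xi)$ to its functional calculus.
  refine (CStarMatrix.commute_diagonal_iff _ S).mp ?_ i j
  have hc : Commute (NCPoly.evalMatrix Xi f)
      (CStarMatrix.ofMatrix (Matrix.diagonal fun _ => S)) :=
    (CStarMatrix.commute_diagonal_iff _ S).mpr fun i j => NCPoly.commute_eval hS (f i j)
  exact hc.cfc (by rwa [ha.star_eq]) g

end BoltzmannFock

/-- For every `n ≥ 1` and every self-adjoint `f ∈ Mat_n(ℂ⟨X⟩)`, `supp μ_f = Spec(f(Ξ))` as subsets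
of the complex plane. -/
theorem proposition3p13 (n : ℕ) [NeZero n] (f : Matrix (Fin n) (Fin n) NCPoly)
    (hf : IsSelfAdjoint f) :
    Complex.ofReal '' (BoltzmannFock.mu f hf).support =
      spectrum ℂ (NCPoly.evalMatrix BoltzmannFock.Xi f) :=
  (isLaw_law _ _).ofReal_image_support_eq
    (NCPoly.isSelfAdjoint_evalMatrix BoltzmannFock.Xi BoltzmannFock.isSelfAdjoint_Xi hf)
    (BoltzmannFock.cfc_evalMatrix_eq_zero hf)
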